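/- Let $L\ge 0$ be an integer and let $q$ be an indeterminate (or, more generally, an element of any field with $q^k\neq 1$ for all $k\ge 1$). Write $(a;q)_n=\prod_{i=0}^{n-1}(1-aq^i)$ for $n\ge 0$, with the convention $1/(q;q)_n=0$ for $n<0$; let ${N\brack k}_q=\frac{(q;q)_N}{(q;q)_k(q;q)_{N-k}}$ for $0\le k\le N$ and ${N\brack k}_q=0$ otherwise; and let $\left(\frac{\cdot}{3}\right)$ be the Jacobi symbol. Then $$\sum_{m,n\ge 0}\frac{q^{2m^2+6mn+6n^2}(q;q)_L}{(q;q)_{L-3n-2m}(q;q)_m(q^3;q^3)_n}=\sum_{j=-L}^{L}\left(\frac{j+1}{3}\right)q^{j^2}{2L\brack L-j}_q$$ and $$\sum_{m,n\ge 0}\frac{q^{2m^2+6mn+6n^2+m+3n}(q;q)_L}{(q;q)_{L-3n-2m}(q;q)_m(q^3;q^3)_n}+q\sum_{m,n\ge 0}\frac{q^{2m^2+6mn+6n^2+3m+6n}(q;q)_L}{(q;q)_{L-3n-2m-1}(q;q)_m(q^3;q^3)_n}=\sum_{j=-L}^{L}\left(\frac{j+1}{3}\right)q^{j(j+1)}{2L\brack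 L-j}_q .$$ -/

import Mathlib

open scoped BigOperators

/-- The `q`-Pochhammer symbol `(a;q)_n = (1-a)(1-aq)⋯(1-aq^(n-1))`. -/
def qPoch {K : Type*} [Field K] (a q : K) (n : ℕ) : K :=
  ∏ i ∈ Finset.range n, (1 - a * q ^ i)

/-- The reciprocal `1/(q;q)_n` for an integer index `n`, equal to `0` for negative `n`. -/
def invQPoch {K : Type*} [Field K] (q : K) (n : ℤ) : K :=
  if 0 ≤ n then 1 / qPoch q q n.toNat else 0

/-- The `q`-binomial coefficient `[N, k]_q = (q;q)_N / ((q;q)_k (q;q)_(N-k))` when `k ≥ 0` and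
`N - k ≥ 0`, and `0` otherwise. -/
def qBinom {K : Type*} [Field K] (q : K) (N k : ℤ) : K :=
  if 0 ≤ k ∧ 0 ≤ N - k then
    qPoch q q N.toNat / (qPoch q q k.toNat * qPoch q q (N - k).toNat)
  else 0

/-- The term of the double sums: `q^e (q;q)_L / ((q;q)_r (q;q)_m (q³;q³)_n)`, where the integer
index `r` may be negative. -/
def capparelliTerm {K : Type*} [Field K] (q : K) (L : ℕ) (e : ℕ) (r : ℤ) (m n : ℕ) : K :=
  q ^ e * qPoch q q L * invQPoch q r / (qPoch q q m * qPoch (q ^ 3) (q ^ 3) n)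

/-- Only finitely many `(m, n)` contribute to a double sum with `r = L - 3n - 2m - c`, `c ≥ 0`,
so that the `∑ᶠ` over all `(m, n)` is an honest sum. -/
theorem capparelliTerm_support_finite {K : Type*} [Field K] (q : K) (L c : ℕ) (e : ℕ → ℕ → ℕ) :
    (Function.support fun p : ℕ × ℕ =>
      capparelliTerm q L (e p.1 p.2) ((L : ℤ) - 3 * p.2 - 2 * p.1 - c) p.1 p.2).Finite := by
  refine (Set.finite_Iic ((L, L) : ℕ × ℕ)).subset ?_
  rintro ⟨m, n⟩ h
  by_contra hn
  apply h
  have h1 : ¬ (0 ≤ (L : ℤ) - 3 * n - 2 * m - c) := by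
    intro h2
    apply hn
    rw [Set.mem_Iic, Prod.mk_le_mk]
    omega
  have h3 : invQPoch q ((L : ℤ) - 3 * n - 2 * m - c) = 0 := if_neg h1
  simp only [capparelliTerm, h3, mul_zero, zero_div]

/-! Write `A L`, `B L` for the two sides of the first and second identity. Either side satisfies `A
(L+1) = (1 - q^(2L+1)) A L + q^(L+1) B L` and `B (L+1) = q^(L+1) A (L+1) + (1 - q^(2L+2)) B L`, with
`A 0 = B 0 = 1`, so induction on `L` proves both identities together
(`capparelliCoeff_eq_jacobiBinomSum`). For the character sums, the recurrences follow from the two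
q-Pascal rules, the shift `j ↦ j + 1`, and the vanishing of sums that are odd under a reflection
(`jacobiBinomSum_eq_zero`). For the double sums, let F, G, H be `capparelliSeries`,
`capparelliSeries'`, `capparelliPair`, and E(z) = ∑ z^n/(q;q)_n. Then `A L`, `B L` are (q;q)_L times
the coefficients of z^L in EF and EH, and q-difference equations for F, H and E give the
recurrences. -/

theorem jacobiSym_neg_three (a : ℤ) : jacobiSym (-a) 3 = -jacobiSym a 3 := by
  rw [jacobiSym.neg a (by decide)]
  have : ZMod.χ₄ ((3 : ℕ) : ZMod 4) = -1 := by decide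
  rw [this]; ring

theorem jacobiSym_add_three (a : ℤ) : jacobiSym (a + 3) 3 = jacobiSym a 3 := by
  rw [jacobiSym.mod_left (a + 3) 3, jacobiSym.mod_left a 3]
  congr 1
  omega

theorem jacobiSym_zero_three : jacobiSym 0 3 = 0 := by
  have := jacobiSym_neg_three 0
  simp only [neg_zero] at this
  omega

/-! ### q-binomial coefficients with integer lower index -/

section QBinomial

variable {K : Type*} [Field K] {q : K}

theorem qPoch_zero (a q : K) : qPoch a q 0 = 1 := by simp [qPoch]

theorem qPoch_self_succ (q : K) (n : ℕ) : qPoch q q (n + 1) = qPoch q q n * (1 - q ^ (n + 1)) := by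
  rw [qPoch, Finset.prod_range_succ, ← qPoch, pow_succ']

theorem one_sub_pow_ne_zero (hq : ∀ k : ℕ, 0 < k → q ^ k ≠ 1) (n : ℕ) : 1 - q ^ (n + 1) ≠ 0 :=
  sub_ne_zero.2 (hq _ n.succ_pos).symm

theorem qPoch_self_ne_zero (hq : ∀ k : ℕ, 0 < k → q ^ k ≠ 1) (n : ℕ) : qPoch q q n ≠ 0 := by
  induction n with
  | zero => simp [qPoch_zero]
  | succ n ih => rw [qPoch_self_succ]; exact mul_ne_zero ih (one_sub_pow_ne_zero hq n)

theorem qBinom_eq_zero {n k : ℤ} (h : k < 0 ∨ n < k) : qBinom q n k = 0 :=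
  if_neg (by omega)

theorem qBinom_nat (q : K) (a b : ℕ) :
    qBinom q ((a + b : ℕ) : ℤ) a = qPoch q q (a + b) / (qPoch q q a * qPoch q q b) := by
  rw [qBinom, if_pos (by omega)]
  congr
  omega

theorem qBinom_symm (q : K) (n : ℕ) (k : ℤ) : qBinom q n k = qBinom q n (n - k) := by
  unfold qBinom
  by_cases h : 0 ≤ k ∧ 0 ≤ (n : ℤ) - k
  · rw [if_pos h, if_pos (by omega), sub_sub_cancel, mul_comm (qPoch q q k.toNat)]
  · rw [if_neg h, if_neg (by omega)]

theorem qBinom_zero_right (hq : ∀ k : ℕ, 0 < k → q ^ k ≠ 1) (n : ℕ) : qBinom q n 0 = 1 := by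
  have := qBinom_nat q 0 n
  rw [zero_add, qPoch_zero, one_mul, div_self (qPoch_self_ne_zero hq n)] at this
  exact_mod_cast this

theorem qBinom_succ (hq : ∀ k : ℕ, 0 < k → q ^ k ≠ 1) (n : ℕ) (k : ℤ) :
    qBinom q ((n + 1 : ℕ) : ℤ) k
      = qBinom q n k + q ^ ((n : ℤ) + 1 - k) * qBinom q n (k - 1) := by
  rcases lt_trichotomy k 0 with hk | rfl | hk
  · simp [qBinom_eq_zero (q := q) (Or.inl hk),
      qBinom_eq_zero (q := q) (n := n) (k := k - 1) (Or.inl (by omega))]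
  · rw [qBinom_zero_right hq, qBinom_zero_right hq, qBinom_eq_zero (Or.inl (by omega))]
    simp
  · obtain ⟨a, rfl⟩ : ∃ a : ℕ, k = (a + 1 : ℕ) := ⟨(k - 1).toNat, by omega⟩
    have e1 : ((a + 1 : ℕ) : ℤ) - 1 = a := by push_cast; ring
    rw [e1]
    rcases lt_trichotomy n a with h | rfl | h
    · rw [qBinom_eq_zero (Or.inr (by omega)), qBinom_eq_zero (Or.inr (by omega)),
        qBinom_eq_zero (Or.inr (by omega))]
      simp
    · rw [qBinom_eq_zero (q := q) (n := n) (k := (n + 1 : ℕ)) (Or.inr (by omega)), qBinom_symm,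
        qBinom_symm q n n, sub_self, sub_self, qBinom_zero_right hq, qBinom_zero_right hq]
      simp
    · obtain ⟨b, rfl⟩ : ∃ b : ℕ, n = a + 1 + b := ⟨n - (a + 1), by omega⟩
      have e2 : ((a + 1 + b : ℕ) : ℤ) + 1 - (a + 1 : ℕ) = (b + 1 : ℕ) := by push_cast; ring
      rw [e2, zpow_natCast, qBinom_nat, add_assoc (a + 1) b 1, qBinom_nat,
        show a + 1 + b = a + (b + 1) by ring, qBinom_nat,
        show a + 1 + (b + 1) = a + b + 1 + 1 by ring, show a + (b + 1) = a + b + 1 by ring,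
        qPoch_self_succ q (a + b + 1), qPoch_self_succ q a, qPoch_self_succ q b]
      have h1 := one_sub_pow_ne_zero hq a
      have h2 := one_sub_pow_ne_zero hq b
      have h3 := qPoch_self_ne_zero hq a
      have h4 := qPoch_self_ne_zero hq b
      field_simp
      ring

theorem qBinom_succ' (hq : ∀ k : ℕ, 0 < k → q ^ k ≠ 1) (n : ℕ) (k : ℤ) :
    qBinom q ((n + 1 : ℕ) : ℤ) k = q ^ k * qBinom q n k + qBinom q n (k - 1) := by
  rw [qBinom_symm, qBinom_succ hq, qBinom_symm q n k, qBinom_symm q n (k - 1), add_comm]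
  congr 1
  · congr 2 <;> push_cast <;> ring
  · congr 1; push_cast; ring

end QBinomial

/-! ### Recurrences for the character sums -/

section CharacterSums

variable {K : Type*} [Field K] {q : K}

/-- The sum `∑ j, (j + c | 3) q ^ (j ^ 2 + a j) [n, b - j]_q` over all integers `j`. -/
noncomputable def jacobiBinomSum (q : K) (c a : ℤ) (n : ℕ) (b : ℤ) : K :=
  ∑ᶠ j : ℤ, (jacobiSym (j + c) 3 : K) * q ^ (j ^ 2 + a * j) * qBinom q n (b - j)

theorem finite_support_mul_qBinom (g : ℤ → K) (n : ℕ) (b : ℤ) :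
    (Function.support fun j => g j * qBinom q n (b - j)).Finite := by
  refine (Set.finite_Icc (b - n) b).subset fun j hj => ?_
  by_contra h
  rw [Set.mem_Icc] at h
  exact hj (by simp only [qBinom_eq_zero (q := q) (n := n) (k := b - j) (by omega), mul_zero])

/-- The Pascal factor depends on `j` only through `q^j`, which the linear exponent `a` absorbs; this
keeps the family closed under both Pascal rules. -/
theorem jacobiBinomSum_pascal (hq : ∀ k : ℕ, 0 < k → q ^ k ≠ 1) (h0 : q ≠ 0) (c a : ℤ) (n : ℕ) (b : ℤ) :
    jacobiBinomSum q c a (n + 1) b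
      = jacobiBinomSum q c a n b + q ^ ((n : ℤ) + 1 - b) * jacobiBinomSum q c (a + 1) n (b - 1) := by
  unfold jacobiBinomSum
  rw [mul_finsum, ← finsum_add_distrib (finite_support_mul_qBinom _ _ _)]
  · refine finsum_congr fun j => ?_
    rw [qBinom_succ hq, show (n : ℤ) + 1 - (b - j) = (n + 1 - b) + j by ring,
      zpow_add₀ h0 ((n : ℤ) + 1 - b),
      show j ^ 2 + (a + 1) * j = (j ^ 2 + a * j) + j by ring, zpow_add₀ h0 (j ^ 2 + a * j),
      show b - j - 1 = b - 1 - j by ring]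
    ring
  · refine (finite_support_mul_qBinom (q := q) (fun j => q ^ ((n : ℤ) + 1 - b) *
      ((jacobiSym (j + c) 3 : K) * q ^ (j ^ 2 + (a + 1) * j))) n (b - 1)).subset fun j hj => ?_
    simpa only [Function.mem_support, mul_assoc] using hj

theorem jacobiBinomSum_pascal' (hq : ∀ k : ℕ, 0 < k → q ^ k ≠ 1) (h0 : q ≠ 0) (c a : ℤ) (n : ℕ)
    (b : ℤ) : jacobiBinomSum q c a (n + 1) b
      = q ^ b * jacobiBinomSum q c (a - 1) n b + jacobiBinomSum q c a n (b - 1) := by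
  unfold jacobiBinomSum
  rw [mul_finsum, ← finsum_add_distrib _
    (finite_support_mul_qBinom _ _ _)]
  · refine finsum_congr fun j => ?_
    rw [qBinom_succ' hq, show j ^ 2 + a * j = (j ^ 2 + (a - 1) * j) + j by ring, zpow_add₀ h0,
      zpow_sub₀ h0, show b - j - 1 = b - 1 - j by ring]
    have := zpow_ne_zero j h0
    field_simp
  · refine (finite_support_mul_qBinom (q := q) (fun j => q ^ b *
      ((jacobiSym (j + c) 3 : K) * q ^ (j ^ 2 + (a - 1) * j))) n b).subset fun j hj => ?_
    simpa only [Function.mem_support, mul_assoc] using hj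

theorem jacobiBinomSum_shift (h0 : q ≠ 0) (c a : ℤ) (n : ℕ) (b : ℤ) :
    jacobiBinomSum q c a n b = q ^ (1 + a) * jacobiBinomSum q (c + 1) (a + 2) n (b - 1) := by
  unfold jacobiBinomSum
  rw [mul_finsum, ← finsum_comp_equiv (Equiv.addRight 1)]
  refine finsum_congr fun j => ?_
  rw [Equiv.coe_addRight, show (j + 1) ^ 2 + a * (j + 1) = (1 + a) + (j ^ 2 + (a + 2) * j) by ring,
    zpow_add₀ h0, show j + 1 + c = j + (c + 1) by ring, show b - (j + 1) = b - 1 - j by ring]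
  ring

/-- The reflection `j ↦ -a - j` fixes `j^2 + a j`, swaps the two symmetric q-binomials (by `hn`) and
negates the character (`hc` says `a ≡ 2c` mod 3). Pairing terms off, rather than deducing `S = -S`,
also covers characteristic 2. -/
theorem jacobiBinomSum_eq_zero {c a : ℤ} {n : ℕ} {b : ℤ} (hn : (n : ℤ) = 2 * b + a)
    (hc : ∀ x, jacobiSym (x + (a - c)) 3 = jacobiSym (x + c) 3) : jacobiBinomSum q c a n b = 0 := by
  have key (j : ℤ) : jacobiSym (-a - j + c) 3 = -jacobiSym (j + c) 3 := by
    rw [show -a - j + c = -(j + (a - c)) by ring, jacobiSym_neg_three, hc]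
  have hs := finite_support_mul_qBinom (q := q)
    (fun j => (jacobiSym (j + c) 3 : K) * q ^ (j ^ 2 + a * j)) n b
  have hf (j : ℤ) : (jacobiSym (-a - j + c) 3 : K) * q ^ ((-a - j) ^ 2 + a * (-a - j)) *
      qBinom q n (b - (-a - j)) =
      -((jacobiSym (j + c) 3 : K) * q ^ (j ^ 2 + a * j) * qBinom q n (b - j)) := by
    rw [key, qBinom_symm, show (-a - j) ^ 2 + a * (-a - j) = j ^ 2 + a * j by ring,
      show (n : ℤ) - (b - (-a - j)) = b - j by rw [hn]; ring]
    push_cast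
    ring
  unfold jacobiBinomSum
  rw [finsum_eq_sum_of_support_subset (s := hs.toFinset) _ (by simp)]
  refine Finset.sum_involution (fun j _ => -a - j) (fun j _ => ?_) (fun j _ hj hfix => ?_)
    (fun j hj => ?_) (fun j _ => by ring)
  · rw [hf, add_neg_cancel]
  · have := key j
    rw [hfix] at this
    have h0 : jacobiSym (j + c) 3 = 0 := by omega
    simp [h0] at hj
  · rw [Set.Finite.mem_toFinset, Function.mem_support] at hj ⊢
    rw [hf]
    exact neg_ne_zero.2 hj

theorem jacobiBinomSum_one_one_odd (hq : ∀ k : ℕ, 0 < k → q ^ k ≠ 1) (h0 : q ≠ 0) (L : ℕ) :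
    jacobiBinomSum q 1 1 (2 * L + 1) L = jacobiBinomSum q 1 1 (2 * L) L := by
  have h1 := jacobiBinomSum_pascal hq h0 1 1 (2 * L) L
  have h2 := jacobiBinomSum_shift h0 0 0 (2 * L) L
  have h3 : jacobiBinomSum q 0 0 (2 * L) L = 0 := jacobiBinomSum_eq_zero (by push_cast; ring) (by simp)
  rw [h3] at h2
  norm_num at h1 h2
  have h4 := h2.resolve_left h0
  rw [h1, h4, mul_zero, add_zero]

theorem jacobiBinomSum_one_zero_succ (hq : ∀ k : ℕ, 0 < k → q ^ k ≠ 1) (h0 : q ≠ 0) (L : ℕ) :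
    jacobiBinomSum q 1 0 (2 * (L + 1)) ((L + 1 : ℕ) : ℤ)
      = (1 - q ^ (2 * L + 1)) * jacobiBinomSum q 1 0 (2 * L) L
        + q ^ (L + 1) * jacobiBinomSum q 1 1 (2 * L) L := by
  have h1 := jacobiBinomSum_pascal hq h0 1 0 (2 * L + 1) ((L + 1 : ℕ) : ℤ)
  have h2 := jacobiBinomSum_pascal' hq h0 1 0 (2 * L) ((L + 1 : ℕ) : ℤ)
  have h3 := jacobiBinomSum_shift h0 1 (-1) (2 * L) ((L + 1 : ℕ) : ℤ)
  -- This vanishing, with `h5` and `h6`, turns the unwanted sum of `h3` into `-q^L` times the sum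
  -- for `A L`.
  have h4 : jacobiBinomSum q 2 1 (2 * L + 1) L = 0 :=
    jacobiBinomSum_eq_zero (by push_cast; ring) fun x => by
      rw [← jacobiSym_add_three]; congr 1; ring
  have h5 := jacobiBinomSum_pascal hq h0 2 1 (2 * L) L
  have h6 := jacobiBinomSum_shift h0 1 0 (2 * L) L
  rw [show ((2 * L + 1 : ℕ) : ℤ) + 1 - ((L + 1 : ℕ) : ℤ) = (L + 1 : ℕ) by push_cast; ring,
    zpow_natCast] at h1
  rw [zpow_natCast] at h2
  rw [show ((2 * L : ℕ) : ℤ) + 1 - (L : ℤ) = (L + 1 : ℕ) by push_cast; ring, zpow_natCast, h4] at h5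
  norm_num at h1 h2 h3 h5 h6
  rw [jacobiBinomSum_one_one_odd hq h0] at h1
  rw [mul_add, mul_one]
  norm_num
  rw [h1, h2, h3]
  linear_combination (-q ^ (L + 1)) * h5 + q ^ (2 * L + 1) * h6

theorem jacobiBinomSum_one_one_succ (hq : ∀ k : ℕ, 0 < k → q ^ k ≠ 1) (h0 : q ≠ 0) (L : ℕ) :
    jacobiBinomSum q 1 1 (2 * (L + 1)) ((L + 1 : ℕ) : ℤ)
      = q ^ (L + 1) * jacobiBinomSum q 1 0 (2 * (L + 1)) ((L + 1 : ℕ) : ℤ)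
        + (1 - q ^ (2 * L + 2)) * jacobiBinomSum q 1 1 (2 * L) L := by
  -- Pascal is applied one row higher, at `2L + 3`; the odd-row lemma then brings the left side back
  -- to row `2L + 2`.
  have h1 := jacobiBinomSum_pascal' hq h0 1 1 (2 * (L + 1)) ((L + 1 : ℕ) : ℤ)
  have h2 := jacobiBinomSum_pascal hq h0 1 1 (2 * L + 1) L
  have h3 := jacobiBinomSum_shift h0 0 0 (2 * L + 1) L
  have h4 : jacobiBinomSum q 0 0 (2 * L + 1 + 1) ((L + 1 : ℕ) : ℤ) = 0 :=
    jacobiBinomSum_eq_zero (by push_cast; ring) (by simp)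
  have h5 := jacobiBinomSum_pascal' hq h0 0 0 (2 * L + 1) ((L + 1 : ℕ) : ℤ)
  have h6 := jacobiBinomSum_shift h0 0 (-1) (2 * L + 1) ((L + 1 : ℕ) : ℤ)
  rw [zpow_natCast, jacobiBinomSum_one_one_odd hq h0] at h1
  rw [show ((2 * L + 1 : ℕ) : ℤ) + 1 - (L : ℤ) = (L + 2 : ℕ) by push_cast; ring, zpow_natCast,
    jacobiBinomSum_one_one_odd hq h0] at h2
  rw [zpow_natCast, h4] at h5
  norm_num at h1 h2 h3 h5 h6
  rw [jacobiBinomSum_one_one_odd hq h0] at h6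
  rw [show 2 * (L + 1) = 2 * L + 1 + 1 by ring] at h1 ⊢
  norm_num
  rw [h1, h2]
  linear_combination (-q ^ (L + 1)) * h5 - q ^ (L + 1) * h3 - q ^ (2 * L + 2) * h6

theorem sum_Icc_eq_jacobiBinomSum (q : K) (a : ℤ) (L : ℕ) :
    ∑ j ∈ Finset.Icc (-(L : ℤ)) (L : ℤ), (jacobiSym (j + 1) 3 : K) * q ^ (j ^ 2 + a * j) *
      qBinom q (2 * (L : ℤ)) ((L : ℤ) - j) = jacobiBinomSum q 1 a (2 * L) L := by
  unfold jacobiBinomSum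
  rw [finsum_eq_sum_of_support_subset (s := Finset.Icc (-(L : ℤ)) (L : ℤ))]
  · push_cast; rfl
  · intro j hj
    by_contra h
    rw [Finset.coe_Icc, Set.mem_Icc] at h
    exact hj (by simp only [qBinom_eq_zero (q := q) (n := (2 * L : ℕ)) (k := L - j)
      (by push_cast; omega), mul_zero])

/-- The recurrences above divide by `q`, so `q = 0` is treated directly. For `a = 1` the exponent
also vanishes at `j = -1`, but there the character is 0. -/
theorem jacobiBinomSum_one_eq_one_of_eq_zero {a : ℤ} (ha : a = 0 ∨ a = 1) (L : ℕ) :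
    jacobiBinomSum (0 : K) 1 a (2 * L) L = 1 := by
  unfold jacobiBinomSum
  rw [finsum_eq_single _ 0]
  · have : qPoch (0 : K) 0 = fun _ => 1 := by
      funext n; simp [qPoch]
    simp only [qBinom, this]
    rw [if_pos (by push_cast; omega)]
    simp
  · intro j hj
    rcases ha with rfl | rfl
    · rw [zero_zpow _ (by simpa using hj)]; ring
    · rcases eq_or_ne j (-1) with rfl | hj'
      · simp [jacobiSym_zero_three]
      · rw [zero_zpow _ (by
          rw [show j ^ 2 + 1 * j = j * (j + 1) by ring]
          exact mul_ne_zero hj (by omega))]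
        ring

end CharacterSums

/-! ### Generating functions of the double sums -/

section DoubleSums

open PowerSeries

variable {K : Type*} [Field K] {q : K}

/-- The pairs `(m, n)` with `2m + 3n = N`. -/
def twoThreePairs (N : ℕ) : Finset (ℕ × ℕ) :=
  ((Finset.range (N + 1)) ×ˢ (Finset.range (N + 1))).filter fun p => 2 * p.1 + 3 * p.2 = N

theorem mem_twoThreePairs {N : ℕ} {p : ℕ × ℕ} :
    p ∈ twoThreePairs N ↔ 2 * p.1 + 3 * p.2 = N := by
  simp only [twoThreePairs, Finset.mem_filter, Finset.mem_product, Finset.mem_range]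
  omega

/-- The power series `∑ φ(m, n) z^(2m+3n)`. -/
noncomputable def twoThreeSeries (φ : ℕ × ℕ → K) : PowerSeries K :=
  PowerSeries.mk fun N => ∑ p ∈ twoThreePairs N, φ p

theorem twoThreeSeries_add (φ ψ : ℕ × ℕ → K) :
    twoThreeSeries (φ + ψ) = twoThreeSeries φ + twoThreeSeries ψ := by
  ext N
  simp [twoThreeSeries, Finset.sum_add_distrib]

theorem twoThreeSeries_const_mul (a : K) (φ : ℕ × ℕ → K) :
    twoThreeSeries (fun p => a * φ p) = C a * twoThreeSeries φ := by
  ext N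
  simp [twoThreeSeries, Finset.mul_sum]

theorem rescale_twoThreeSeries (a : K) (φ : ℕ × ℕ → K) :
    rescale a (twoThreeSeries φ) = twoThreeSeries fun p => a ^ (2 * p.1 + 3 * p.2) * φ p := by
  ext N
  simp only [twoThreeSeries, coeff_rescale, coeff_mk, Finset.mul_sum]
  exact Finset.sum_congr rfl fun p hp => by rw [mem_twoThreePairs.1 hp]

theorem twoThreeSeries_shift_left {φ ψ : ℕ × ℕ → K} (h0 : ∀ n, ψ (0, n) = 0)
    (h : ∀ m n, ψ (m + 1, n) = φ (m, n)) :
    twoThreeSeries ψ = X ^ 2 * twoThreeSeries φ := by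
  ext N
  rw [coeff_X_pow_mul']
  simp only [twoThreeSeries, coeff_mk]
  split_ifs with hN
  · symm
    refine Finset.sum_of_injOn (fun p => (p.1 + 1, p.2)) ?_ ?_ ?_ ?_
    · rintro ⟨a, b⟩ _ ⟨c, d⟩ _ h
      simpa using h
    · rintro ⟨a, b⟩ hp
      simp only [Finset.mem_coe, mem_twoThreePairs] at hp ⊢
      omega
    · rintro ⟨_ | a, b⟩ hp hp'
      · exact h0 b
      · refine absurd ⟨(a, b), ?_, rfl⟩ hp'
        simp only [Finset.mem_coe, mem_twoThreePairs] at hp ⊢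
        omega
    · rintro ⟨a, b⟩ _
      exact (h a b).symm
  · refine Finset.sum_eq_zero fun ⟨a, b⟩ hp => ?_
    rw [mem_twoThreePairs] at hp
    obtain rfl : a = 0 := by simp only at hp; omega
    exact h0 b

theorem twoThreeSeries_shift_right {φ ψ : ℕ × ℕ → K} (h0 : ∀ m, ψ (m, 0) = 0)
    (h : ∀ m n, ψ (m, n + 1) = φ (m, n)) :
    twoThreeSeries ψ = X ^ 3 * twoThreeSeries φ := by
  ext N
  rw [coeff_X_pow_mul']
  simp only [twoThreeSeries, coeff_mk]
  split_ifs with hN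
  · symm
    refine Finset.sum_of_injOn (fun p => (p.1, p.2 + 1)) ?_ ?_ ?_ ?_
    · rintro ⟨a, b⟩ _ ⟨c, d⟩ _ h
      simpa using h
    · rintro ⟨a, b⟩ hp
      simp only [Finset.mem_coe, mem_twoThreePairs] at hp ⊢
      omega
    · rintro ⟨a, _ | b⟩ hp hp'
      · exact h0 a
      · refine absurd ⟨(a, b), ?_, rfl⟩ hp'
        simp only [Finset.mem_coe, mem_twoThreePairs] at hp ⊢
        omega
    · rintro ⟨a, b⟩ _
      exact (h a b).symm
  · refine Finset.sum_eq_zero fun ⟨a, b⟩ hp => ?_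
    rw [mem_twoThreePairs] at hp
    obtain rfl : b = 0 := by simp only at hp; omega
    exact h0 a

/-- The summand `q^(2m²+6mn+6n²) / ((q;q)_m (q³;q³)_n)`. -/
noncomputable def capparelliWeight (q : K) (p : ℕ × ℕ) : K :=
  q ^ (2 * p.1 ^ 2 + 6 * p.1 * p.2 + 6 * p.2 ^ 2) / (qPoch q q p.1 * qPoch (q ^ 3) (q ^ 3) p.2)

theorem pow_three_pow_ne_one (hq : ∀ k : ℕ, 0 < k → q ^ k ≠ 1) (k : ℕ) (hk : 0 < k) :
    (q ^ 3) ^ k ≠ 1 := by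
  rw [← pow_mul]; exact hq _ (by omega)

theorem capparelliWeight_succ_left (hq : ∀ k : ℕ, 0 < k → q ^ k ≠ 1) (m n : ℕ) :
    (1 - q ^ (m + 1)) * capparelliWeight q (m + 1, n)
      = q ^ (4 * m + 6 * n + 2) * capparelliWeight q (m, n) := by
  have h1 := one_sub_pow_ne_zero hq m
  have h2 := qPoch_self_ne_zero hq m
  have h3 := qPoch_self_ne_zero (pow_three_pow_ne_one hq) n
  simp only [capparelliWeight, qPoch_self_succ]
  field_simp
  ring

theorem capparelliWeight_succ_right (hq : ∀ k : ℕ, 0 < k → q ^ k ≠ 1) (m n : ℕ) :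
    (1 - q ^ (3 * (n + 1))) * capparelliWeight q (m, n + 1)
      = q ^ (6 * m + 12 * n + 6) * capparelliWeight q (m, n) := by
  have h1 := one_sub_pow_ne_zero (pow_three_pow_ne_one hq) n
  have h2 := qPoch_self_ne_zero hq m
  have h3 := qPoch_self_ne_zero (pow_three_pow_ne_one hq) n
  rw [pow_mul]
  simp only [capparelliWeight, qPoch_self_succ]
  field_simp
  ring

/-- The series `∑ q^(2m²+6mn+6n²) z^(2m+3n) / ((q;q)_m (q³;q³)_n)`. -/
noncomputable def capparelliSeries (q : K) : PowerSeries K :=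
  twoThreeSeries (capparelliWeight q)

/-- The series `∑ q^(2m²+6mn+6n²+m+3n) z^(2m+3n) / ((q;q)_m (q³;q³)_n)`. -/
noncomputable def capparelliSeries' (q : K) : PowerSeries K :=
  twoThreeSeries fun p => q ^ (p.1 + 3 * p.2) * capparelliWeight q p

/-- The weights of G(z) - F(qz) carry the factor `1 - q^m`, which cancels against (q;q)_m and shifts
`m` by one. -/
theorem capparelliSeries'_eq (hq : ∀ k : ℕ, 0 < k → q ^ k ≠ 1) :
    capparelliSeries' q = rescale q (capparelliSeries q)
      + C (q ^ 3) * X ^ 2 * rescale (q ^ 2) (capparelliSeries' q) := by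
  unfold capparelliSeries capparelliSeries'
  rw [rescale_twoThreeSeries, rescale_twoThreeSeries, mul_comm (C _), mul_assoc,
    ← twoThreeSeries_const_mul, ← twoThreeSeries_shift_left
      (ψ := fun p => q ^ (p.1 + 3 * p.2) * (1 - q ^ p.1) * capparelliWeight q p),
    ← twoThreeSeries_add]
  · congr 1
    funext p
    simp only [Pi.add_apply]
    ring
  · intro n; simp
  · intro m n
    simp only
    rw [mul_assoc, capparelliWeight_succ_left hq]
    ring

/-- Split `1 - q^(m+3n) = (1 - q^m) + q^m (1 - q^(3n))`; the two pieces shift `m` and `n`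
respectively. -/
theorem capparelliSeries_eq (hq : ∀ k : ℕ, 0 < k → q ^ k ≠ 1) :
    capparelliSeries q = capparelliSeries' q
      + C (q ^ 2) * X ^ 2 * rescale (q ^ 2) (capparelliSeries q)
      + C (q ^ 6) * X ^ 3 * rescale (q ^ 3) (capparelliSeries' q) := by
  unfold capparelliSeries capparelliSeries'
  rw [rescale_twoThreeSeries, rescale_twoThreeSeries, mul_comm (C _), mul_assoc,
    ← twoThreeSeries_const_mul, mul_comm (C _), mul_assoc, ← twoThreeSeries_const_mul,
    ← twoThreeSeries_shift_left (ψ := fun p => (1 - q ^ p.1) * capparelliWeight q p),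
    ← twoThreeSeries_shift_right
      (ψ := fun p => q ^ p.1 * ((1 - q ^ (3 * p.2)) * capparelliWeight q p)),
    ← twoThreeSeries_add, ← twoThreeSeries_add]
  · congr 1
    funext p
    simp only [Pi.add_apply]
    ring
  · intro n; simp
  · intro m n
    simp only
    rw [capparelliWeight_succ_right hq]
    ring
  · intro n; simp
  · intro m n
    simp only
    rw [capparelliWeight_succ_left hq]
    ring

/-- The series `∑ z^n / (q;q)_n`. -/
noncomputable def qExpSeries (q : K) : PowerSeries K :=
  PowerSeries.mk fun n => 1 / qPoch q q n

theorem one_sub_X_mul_qExpSeries (hq : ∀ k : ℕ, 0 < k → q ^ k ≠ 1) :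
    (1 - X) * qExpSeries q = rescale q (qExpSeries q) := by
  ext n
  rw [sub_mul, one_mul, map_sub, coeff_rescale]
  cases n with
  | zero => simp [qExpSeries]
  | succ n =>
    rw [coeff_succ_X_mul]
    simp only [qExpSeries, coeff_mk, qPoch_self_succ]
    have h1 := one_sub_pow_ne_zero hq n
    have h2 := qPoch_self_ne_zero hq n
    field_simp
    ring

theorem rescale_C' (a b : K) : rescale a (C b) = C b := by
  ext n
  rw [coeff_rescale, coeff_C]
  split_ifs with h <;> simp [h]

/-- The generating function of the left-hand sides of the second identity, without the factor
`∑ z^n / (q;q)_n`. -/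
noncomputable def capparelliPair (q : K) : PowerSeries K :=
  capparelliSeries' q + C q * X * rescale q (capparelliSeries' q)

theorem capparelliPair_eq (hq : ∀ k : ℕ, 0 < k → q ^ k ≠ 1) :
    capparelliPair q = rescale q (capparelliSeries q)
      + C q * X * rescale q (capparelliPair q) := by
  have h := capparelliSeries'_eq hq
  have h2 : rescale q (rescale q (capparelliSeries' q)) = rescale (q ^ 2) (capparelliSeries' q) := by
    rw [rescale_rescale, pow_two]
  unfold capparelliPair
  simp only [map_add, map_mul, rescale_C', rescale_X, h2]
  simp only [map_pow] at h
  linear_combination h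

/-- Expanding G(qz) in H(z) = G(z) + qzG(qz) produces the same G(q³z) term as the equation for F, so
G is eliminated. -/
theorem capparelliPair_eq' (hq : ∀ k : ℕ, 0 < k → q ^ k ≠ 1) :
    capparelliPair q = capparelliSeries q
      + C q * X * (1 - C q * X) * rescale (q ^ 2) (capparelliSeries q) := by
  have h := capparelliSeries_eq hq
  have h1 := congrArg (rescale q) (capparelliSeries'_eq hq)
  have h2 : rescale q (rescale q (capparelliSeries q)) = rescale (q ^ 2) (capparelliSeries q) := by
    rw [rescale_rescale, pow_two]
  have h3 : rescale q (rescale (q ^ 2) (capparelliSeries' q))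
      = rescale (q ^ 3) (capparelliSeries' q) := by
    rw [rescale_rescale, ← pow_succ]
  unfold capparelliPair
  simp only [map_add, map_mul, map_pow, rescale_C', rescale_X, h2, h3] at h1 h
  linear_combination C q * X * h1 - h

/-- `(q;q)_L` times the coefficient of `z^L` in `E F`, where `E = ∑ z^n / (q;q)_n`. -/
noncomputable def capparelliCoeff (q : K) (F : PowerSeries K) (L : ℕ) : K :=
  qPoch q q L * coeff L (qExpSeries q * F)

theorem capparelliCoeff_series_succ (hq : ∀ k : ℕ, 0 < k → q ^ k ≠ 1) (L : ℕ) :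
    capparelliCoeff q (capparelliSeries q) (L + 1)
      = (1 - q ^ (2 * L + 1)) * capparelliCoeff q (capparelliSeries q) L
        + q ^ (L + 1) * capparelliCoeff q (capparelliPair q) L := by
  have e1 := one_sub_X_mul_qExpSeries hq
  have e2 := congrArg (rescale q) e1
  rw [rescale_rescale, ← pow_two] at e2
  simp only [map_sub, map_mul, map_one, rescale_X] at e2
  -- Equate the two expressions for H, multiply by E(qz) = (1 - z)E(z), and use (1 - qz)E(qz) =
  -- E(q²z).
  have key : qExpSeries q * capparelliSeries q - rescale q (qExpSeries q * capparelliSeries q)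
      = X * (qExpSeries q * capparelliSeries q
        - C q * rescale (q ^ 2) (qExpSeries q * capparelliSeries q)
        + C q * rescale q (qExpSeries q * capparelliPair q)) := by
    have p1 := capparelliPair_eq hq
    have p2 := capparelliPair_eq' hq
    simp only [map_mul]
    linear_combination capparelliSeries q * e1
      - C q * X * rescale (q ^ 2) (capparelliSeries q) * e2 + rescale q (qExpSeries q) * (p1 - p2)
  have hc := congrArg (coeff (L + 1)) key
  rw [coeff_succ_X_mul] at hc
  simp only [map_sub, map_add, coeff_rescale, coeff_C_mul] at hc
  unfold capparelliCoeff
  rw [qPoch_self_succ]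
  linear_combination qPoch q q L * hc

theorem capparelliCoeff_pair_succ (hq : ∀ k : ℕ, 0 < k → q ^ k ≠ 1) (L : ℕ) :
    capparelliCoeff q (capparelliPair q) (L + 1)
      = q ^ (L + 1) * capparelliCoeff q (capparelliSeries q) (L + 1)
        + (1 - q ^ (2 * L + 2)) * capparelliCoeff q (capparelliPair q) L := by
  have e1 := one_sub_X_mul_qExpSeries hq
  have key : qExpSeries q * capparelliPair q = rescale q (qExpSeries q * capparelliSeries q)
      + X * (qExpSeries q * capparelliPair q
        + C q * rescale q (qExpSeries q * capparelliPair q)) := by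
    have p1 := capparelliPair_eq hq
    simp only [map_mul]
    linear_combination capparelliPair q * e1 + rescale q (qExpSeries q) * p1
  have hc := congrArg (coeff (L + 1)) key
  rw [map_add, coeff_succ_X_mul] at hc
  simp only [map_add, coeff_rescale, coeff_C_mul] at hc
  unfold capparelliCoeff
  rw [qPoch_self_succ]
  linear_combination qPoch q q L * (1 - q ^ (L + 1)) * hc

theorem capparelliCoeff_series_zero (q : K) : capparelliCoeff q (capparelliSeries q) 0 = 1 := by
  have : twoThreePairs 0 = {(0, 0)} := by decide
  simp [capparelliCoeff, capparelliSeries, qExpSeries, twoThreeSeries, this, capparelliWeight,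
    qPoch_zero, coeff_mul]

theorem capparelliCoeff_pair_zero (q : K) : capparelliCoeff q (capparelliPair q) 0 = 1 := by
  have : twoThreePairs 0 = {(0, 0)} := by decide
  simp [capparelliCoeff, capparelliPair, capparelliSeries', qExpSeries, twoThreeSeries, this,
    capparelliWeight, qPoch_zero, coeff_mul, mul_assoc]

theorem capparelliCoeff_eq_jacobiBinomSum (hq : ∀ k : ℕ, 0 < k → q ^ k ≠ 1) (L : ℕ) :
    capparelliCoeff q (capparelliSeries q) L = jacobiBinomSum q 1 0 (2 * L) L ∧
      capparelliCoeff q (capparelliPair q) L = jacobiBinomSum q 1 1 (2 * L) L := by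
  induction L with
  | zero =>
    rw [capparelliCoeff_series_zero, capparelliCoeff_pair_zero, ← sum_Icc_eq_jacobiBinomSum,
      ← sum_Icc_eq_jacobiBinomSum]
    simp [qBinom, qPoch_zero]
  | succ L ih =>
    rw [capparelliCoeff_pair_succ hq, capparelliCoeff_series_succ hq, ih.1, ih.2]
    rcases eq_or_ne q 0 with rfl | h0
    · rw [jacobiBinomSum_one_eq_one_of_eq_zero (Or.inl rfl),
        jacobiBinomSum_one_eq_one_of_eq_zero (Or.inr rfl),
        jacobiBinomSum_one_eq_one_of_eq_zero (Or.inl rfl),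
        jacobiBinomSum_one_eq_one_of_eq_zero (Or.inr rfl)]
      simp
    · rw [jacobiBinomSum_one_one_succ hq h0, jacobiBinomSum_one_zero_succ hq h0]
      exact ⟨rfl, rfl⟩

/-! ### Double sums as power series coefficients -/

theorem capparelliTerm_eq (q : K) (L e : ℕ) (r : ℤ) (p : ℕ × ℕ) :
    capparelliTerm q L (2 * p.1 ^ 2 + 6 * p.1 * p.2 + 6 * p.2 ^ 2 + e) r p.1 p.2
      = qPoch q q L * (invQPoch q r * (q ^ e * capparelliWeight q p)) := by
  rw [capparelliTerm, capparelliWeight, pow_add]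
  ring

theorem invQPoch_natCast (q : K) (n : ℕ) : invQPoch q n = 1 / qPoch q q n := by
  simp [invQPoch]

theorem invQPoch_of_neg (q : K) {r : ℤ} (h : r < 0) : invQPoch q r = 0 :=
  if_neg (not_le.2 h)

/-- Group the pairs by `b = 2m + 3n`: those with `b > L` vanish by the convention on `invQPoch`, and
the rest form the Cauchy product. -/
theorem finsum_invQPoch_mul (q : K) (L : ℕ) (φ : ℕ × ℕ → K) :
    ∑ᶠ p : ℕ × ℕ, invQPoch q ((L : ℤ) - 3 * p.2 - 2 * p.1) * φ p
      = coeff L (qExpSeries q * twoThreeSeries φ) := by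
  rw [finsum_eq_sum_of_support_subset
    (s := (Finset.range (L + 1)).biUnion fun b => twoThreePairs b), Finset.sum_biUnion, mul_comm,
    coeff_mul, Finset.Nat.sum_antidiagonal_eq_sum_range_succ_mk]
  · refine Finset.sum_congr rfl fun b hb => ?_
    simp only [twoThreeSeries, qExpSeries, coeff_mk, Finset.sum_mul]
    refine Finset.sum_congr rfl fun p hp => ?_
    rw [mem_twoThreePairs] at hp
    rw [Finset.mem_range] at hb
    rw [show (L : ℤ) - 3 * p.2 - 2 * p.1 = (L - b : ℕ) by omega, invQPoch_natCast, mul_comm]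
  · intro b _ b' _ hbb'
    refine Finset.disjoint_left.2 fun p hp hp' => hbb' ?_
    rw [mem_twoThreePairs] at hp hp'
    exact hp.symm.trans hp'
  · intro p hp
    by_contra h
    refine hp ?_
    simp only [Finset.coe_biUnion, Set.mem_iUnion, Finset.mem_coe, mem_twoThreePairs,
      Finset.mem_range, exists_prop, exists_eq_right'] at h
    simp only
    rw [invQPoch_of_neg q (by omega), zero_mul]

theorem finsum_capparelliTerm (q : K) (L l : ℕ) (e : ℕ × ℕ → ℕ) :
    ∑ᶠ p : ℕ × ℕ, capparelliTerm q L (2 * p.1 ^ 2 + 6 * p.1 * p.2 + 6 * p.2 ^ 2 + e p)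
        ((l : ℤ) - 3 * p.2 - 2 * p.1) p.1 p.2
      = qPoch q q L * coeff l (qExpSeries q *
          twoThreeSeries fun p => q ^ e p * capparelliWeight q p) := by
  rw [← finsum_invQPoch_mul, mul_finsum]
  exact finsum_congr fun p => capparelliTerm_eq q L _ _ p

theorem finsum_capparelliTerm_series (q : K) (L : ℕ) :
    ∑ᶠ p : ℕ × ℕ, capparelliTerm q L (2 * p.1 ^ 2 + 6 * p.1 * p.2 + 6 * p.2 ^ 2)
        ((L : ℤ) - 3 * p.2 - 2 * p.1) p.1 p.2 = capparelliCoeff q (capparelliSeries q) L := by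
  have := finsum_capparelliTerm q L L fun _ => 0
  simp only [add_zero, pow_zero, one_mul] at this
  exact this

theorem finsum_capparelliTerm_pair (q : K) (L : ℕ) :
    (∑ᶠ p : ℕ × ℕ,
        capparelliTerm q L (2 * p.1 ^ 2 + 6 * p.1 * p.2 + 6 * p.2 ^ 2 + p.1 + 3 * p.2)
          ((L : ℤ) - 3 * p.2 - 2 * p.1) p.1 p.2)
      + q * (∑ᶠ p : ℕ × ℕ,
        capparelliTerm q L (2 * p.1 ^ 2 + 6 * p.1 * p.2 + 6 * p.2 ^ 2 + 3 * p.1 + 6 * p.2)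
          ((L : ℤ) - 3 * p.2 - 2 * p.1 - 1) p.1 p.2)
      = capparelliCoeff q (capparelliPair q) L := by
  have h1 := finsum_capparelliTerm q L L fun p => p.1 + 3 * p.2
  simp only [← add_assoc] at h1
  rw [h1, capparelliCoeff, capparelliPair, mul_add, map_add, mul_add]
  congr 1
  rw [show qExpSeries q * (C q * X * rescale q (capparelliSeries' q))
    = C q * (X * (qExpSeries q * rescale q (capparelliSeries' q))) by ring, coeff_C_mul]
  cases L with
  | zero =>
    -- For `L = 0` every index `-3n - 2m - 1` is negative, matching the zero constant term of a
    -- multiple of `X`.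
    rw [finsum_eq_zero_of_forall_eq_zero fun p => ?_]
    · simp
    · simp [capparelliTerm, invQPoch_of_neg q (r := -(3 * (p.2 : ℤ)) - 2 * p.1 - 1) (by omega)]
  | succ l =>
    have h2 := finsum_capparelliTerm q (l + 1) l fun p => 3 * p.1 + 6 * p.2
    simp only [← add_assoc] at h2
    simp only [show ∀ p : ℕ × ℕ, ((l + 1 : ℕ) : ℤ) - 3 * p.2 - 2 * p.1 - 1
      = (l : ℤ) - 3 * p.2 - 2 * p.1 from fun p => by push_cast; ring]
    rw [h2, coeff_succ_X_mul, capparelliSeries', rescale_twoThreeSeries,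
      show (fun p : ℕ × ℕ => q ^ (2 * p.1 + 3 * p.2) *
        (q ^ (p.1 + 3 * p.2) * capparelliWeight q p))
        = fun p => q ^ (3 * p.1 + 6 * p.2) * capparelliWeight q p from funext fun p => by ring]
    ring

end DoubleSums

theorem theorem7 {K : Type*} [Field K] (q : K) (hq : ∀ k : ℕ, 0 < k → q ^ k ≠ 1) (L : ℕ) :
    (∑ᶠ p : ℕ × ℕ,
        capparelliTerm q L (2 * p.1 ^ 2 + 6 * p.1 * p.2 + 6 * p.2 ^ 2)
          ((L : ℤ) - 3 * p.2 - 2 * p.1) p.1 p.2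
      = ∑ j ∈ Finset.Icc (-(L : ℤ)) (L : ℤ),
          (jacobiSym (j + 1) 3 : K) * q ^ (j ^ 2) * qBinom q (2 * (L : ℤ)) ((L : ℤ) - j)) ∧
    ((∑ᶠ p : ℕ × ℕ,
        capparelliTerm q L (2 * p.1 ^ 2 + 6 * p.1 * p.2 + 6 * p.2 ^ 2 + p.1 + 3 * p.2)
          ((L : ℤ) - 3 * p.2 - 2 * p.1) p.1 p.2)
      + q * (∑ᶠ p : ℕ × ℕ,
        capparelliTerm q L (2 * p.1 ^ 2 + 6 * p.1 * p.2 + 6 * p.2 ^ 2 + 3 * p.1 + 6 * p.2)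
          ((L : ℤ) - 3 * p.2 - 2 * p.1 - 1) p.1 p.2)
      = ∑ j ∈ Finset.Icc (-(L : ℤ)) (L : ℤ),
          (jacobiSym (j + 1) 3 : K) * q ^ (j * (j + 1)) *
            qBinom q (2 * (L : ℤ)) ((L : ℤ) - j)) := by
  rw [finsum_capparelliTerm_series, finsum_capparelliTerm_pair,
    (capparelliCoeff_eq_jacobiBinomSum hq L).1, (capparelliCoeff_eq_jacobiBinomSum hq L).2,
    ← sum_Icc_eq_jacobiBinomSum, ← sum_Icc_eq_jacobiBinomSum]
  refine ⟨Finset.sum_congr rfl fun j _ => ?_, Finset.sum_congr rfl fun j _ => ?_⟩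
  · rw [zero_mul, add_zero]
  · rw [show j ^ 2 + 1 * j = j * (j + 1) by ring]
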